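/- For real $a,b>0$ let $GGamma(a,b)$ be the distribution on $(0,\infty)$ with density $\frac{b\,x^{a-1}e^{-x^b}}{\Gamma(a/b)}$. An integrable real random variable $X$ is \emph{sub-gamma to the right} with variance $v$ and scale $c\ge 0$, written $X\in\Gamma^+(v,c)$, if $$\mathbb{E}\left[e^{\lambda(X-\mathbb{E}[X])}\right]\le \exp\left(\frac{\lambda^2 v}{2(1-c\lambda)}\right)\qquad\text{for all }\lambda\in(0,1/c),$$ where $1/c=\infty$ if $c=0$; it is \emph{sub-gamma to the left}, written $X\in\Gamma^-(v,c)$, if $-X\in\Gamma^+(v,c)$. Let $p\ge 4$ be a real number, let $Y\sim GGamma\left(\frac1{p-1},\frac p{p-1}\right)$, and let $\mu=\mathbb{E}[Y]$. Then: 1. $GGamma\left(\frac1{p-1},\frac p{p-1}\right)$ is the law of $|x|^{p-1}$ when $x$ is a real random variable with density proportional to $e^{-|x|^p}$; 2. $Y$ is integrable, $\mu=1/\Gamma(1/p)$, and $\frac1p\le\mu<\frac{1.2}p$; 3. $Y\in\Gamma^+(\mu,1)$ and $Y\in\Gamma^-(\mu,3/2)$. -/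

import Mathlib

open MeasureTheory ProbabilityTheory

noncomputable section

/-- The density of the generalized Gamma distribution `GGamma(a, b)` on `ℝ`:
`b x^(a-1) exp(-x^b) / Γ(a/b)` for `x > 0`, and `0` elsewhere. -/
def ggammaPDFReal (a b x : ℝ) : ℝ :=
  if 0 < x then b * x ^ (a - 1) * Real.exp (-x ^ b) / Real.Gamma (a / b) else 0

/-- The generalized Gamma distribution `GGamma(a, b)`. -/
def ggammaMeasure (a b : ℝ) : Measure ℝ :=
  volume.withDensity (fun x => ENNReal.ofReal (ggammaPDFReal a b x))

/-- `GGamma(a, b)` is a probability measure whenever `a, b > 0`. -/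
theorem isProbabilityMeasure_ggammaMeasure {a b : ℝ} (ha : 0 < a) (hb : 0 < b) :
    IsProbabilityMeasure (ggammaMeasure a b) := by
  have hG : 0 < Real.Gamma (a / b) := Real.Gamma_pos_of_pos (div_pos ha hb)
  have hI := integral_rpow_mul_exp_neg_rpow hb (show (-1 : ℝ) < a - 1 by linarith)
  have hint := integrableOn_rpow_mul_exp_neg_rpow (p := b) (s := a - 1) (by linarith) hb
  rw [sub_add_cancel] at hI
  have hpdf : ggammaPDFReal a b = (Set.Ioi (0 : ℝ)).indicator
      (fun x => b / Real.Gamma (a / b) * (x ^ (a - 1) * Real.exp (-x ^ b))) := by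
    funext x
    by_cases hx : 0 < x
    · simp only [ggammaPDFReal, hx, if_true, Set.indicator, Set.mem_Ioi]; ring
    · simp [ggammaPDFReal, hx, Set.indicator]
  have hint2 : Integrable (ggammaPDFReal a b) := by
    rw [hpdf, integrable_indicator_iff measurableSet_Ioi]
    exact hint.const_mul _
  have hnn : ∀ x, 0 ≤ ggammaPDFReal a b x := by
    intro x
    unfold ggammaPDFReal
    split_ifs with hx
    · positivity
    · exact le_rfl
  refine ⟨?_⟩
  rw [ggammaMeasure, withDensity_apply _ MeasurableSet.univ, Measure.restrict_univ,
    ← ofReal_integral_eq_lintegral_ofReal hint2 (Filter.Eventually.of_forall hnn), hpdf,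
    integral_indicator measurableSet_Ioi, integral_const_mul, hI]
  rw [show b / Real.Gamma (a / b) * (1 / b * Real.Gamma (a / b)) = 1 by field_simp]
  simp

/-- The one-dimensional generalized Gaussian distribution with shape `p` and scale `1`: the
measure on `ℝ` with density proportional to `exp(-|x|^p)`, normalized to total mass `1`. -/
def ggaussMeasure (p : ℝ) : Measure ℝ :=
  (∫⁻ x : ℝ, ENNReal.ofReal (Real.exp (-|x| ^ p)))⁻¹ •
    volume.withDensity (fun x => ENNReal.ofReal (Real.exp (-|x| ^ p)))

/-- `X` is sub-gamma to the right with variance `v` and scale `c` (`X ∈ Γ⁺(v, c)`): for all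
`l ∈ (0, 1/c)`, where `1/c = ∞` if `c = 0`,
`E[exp (l (X - E[X]))] ≤ exp (l² v / (2 (1 - c l)))`.
Both expectations are required to exist. -/
def IsSubGammaRight {Ω : Type*} [MeasurableSpace Ω] (X : Ω → ℝ) (v c : ℝ) (P : Measure Ω) :
    Prop :=
  Integrable X P ∧ ∀ l : ℝ, 0 < l → (c = 0 ∨ l < 1 / c) →
    Integrable (fun ω => Real.exp (l * (X ω - ∫ ω', X ω' ∂P))) P ∧
    ∫ ω, Real.exp (l * (X ω - ∫ ω', X ω' ∂P)) ∂P ≤ Real.exp (l ^ 2 * v / (2 * (1 - c * l)))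

/-- `X` is sub-gamma to the left with variance `v` and scale `c` (`X ∈ Γ⁻(v, c)`) if `-X` is
sub-gamma to the right with the same parameters. -/
def IsSubGammaLeft {Ω : Type*} [MeasurableSpace Ω] (X : Ω → ℝ) (v c : ℝ) (P : Measure Ω) :
    Prop :=
  IsSubGammaRight (fun ω => -X ω) v c P

end

/-! ### Bounds on the Gamma function from convexity -/

section GammaBounds

/-! Everything rests on the explicit moments `E[Y^(k+1)] = μ Γ(k + 1 - k/p)`. Convexity of Γ bounds
them by `μ k!`. Summing the exponential series (`integrable_exp_and_integral_exp_le_of_moments_le`)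
then gives the right tail. The left tail needs only `E[Y²] ≤ μ` and a quadratic bound on `exp (-x)`;
it is in fact sub-Gaussian. In both cases `1 + x ≤ exp x` turns the bound into an exponential and
centring cancels the mean term. Since `p μ = 1 / Γ(1 + 1/p)`, the bounds on `μ` also follow from
convexity: a chord above Γ and its tangent at 1 below. The law of `|x|^(p-1)` is a change of
variables. -/

theorem Real.Gamma_le_factorial_of_mem_Icc {n : ℕ} {s : ℝ} (hs : s ∈ Set.Icc (1 : ℝ) (n + 1)) :
    Real.Gamma s ≤ n.factorial := by
  have h := Real.convexOn_Gamma.le_max_of_mem_Icc (x := (1 : ℝ)) (y := (n : ℝ) + 1)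
    (by simp)
    (show (0 : ℝ) < n + 1 by positivity) hs
  rw [Real.Gamma_one, Real.Gamma_nat_eq_factorial] at h
  exact h.trans (max_le (by exact_mod_cast n.factorial_pos) le_rfl)

/-- Γ lies above its tangent at 1, whose slope is minus the Euler–Mascheroni constant, and that
constant is less than 2/3. -/
theorem Real.one_sub_two_thirds_mul_lt_Gamma {x : ℝ} (hx : 0 < x) :
    1 - 2 / 3 * x < Real.Gamma (1 + x) := by
  have h := Real.convexOn_Gamma.le_slope_of_hasDerivAt (x := 1) (y := 1 + x) (by simp)
    (show (0 : ℝ) < 1 + x by positivity) (by linarith) Real.hasDerivAt_Gamma_one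
  rw [slope_def_field, Real.Gamma_one, le_div_iff₀ (by linarith)] at h
  nlinarith [Real.eulerMascheroniConstant_lt_two_thirds]

theorem Real.one_div_Gamma_one_div_mem_Ico {p : ℝ} (hp : 4 ≤ p) :
    1 / Real.Gamma (1 / p) ∈ Set.Ico (1 / p) (1.2 / p) := by
  have hp0 : 0 < p := by linarith
  have hle : 1 / p ≤ 1 / 4 := one_div_le_one_div_of_le (by norm_num) hp
  have hpos : 0 < 1 / p := by positivity
  have hG : 0 < Real.Gamma (1 / p) := Real.Gamma_pos_of_pos hpos
  have hrec : Real.Gamma (1 + 1 / p) = 1 / p * Real.Gamma (1 / p) := by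
    rw [add_comm, Real.Gamma_add_one hpos.ne']
  have hupper : Real.Gamma (1 + 1 / p) ≤ 1 := by
    simpa using Real.Gamma_le_factorial_of_mem_Icc (n := 1) (s := 1 + 1 / p)
      ⟨by linarith, by norm_num at hle ⊢; linarith⟩
  have hlower := Real.one_sub_two_thirds_mul_lt_Gamma hpos
  rw [hrec] at hupper hlower
  constructor
  · rw [le_div_iff₀ hG]
    exact hupper
  · rw [div_lt_iff₀ hG]
    have : (1.2 : ℝ) / p = 1.2 * (1 / p) := by ring
    rw [this]
    -- Here `p ≥ 4` is exactly what is needed: `1 - (2/3)(1/4) = 5/6 = 1/1.2`.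
    nlinarith

end GammaBounds

/-! ### Sub-gamma criteria from moments -/

section SubGammaCriteria

variable {Ω : Type*} [MeasurableSpace Ω] {P : Measure Ω} [IsProbabilityMeasure P] {X : Ω → ℝ}

theorem Real.exp_neg_le_one_sub_add_sq_div_two {x : ℝ} (hx : 0 ≤ x) :
    Real.exp (-x) ≤ 1 - x + x ^ 2 / 2 := by
  rw [Real.exp_neg]
  refine inv_le_of_inv_le₀ (by nlinarith [sq_nonneg (x - 1)]) ?_
  refine le_trans ?_ (Real.quadratic_le_exp_of_nonneg hx)
  rw [inv_le_iff_one_le_mul₀ (by nlinarith [sq_nonneg (x - 1)])]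
  -- `(1 - x + x²/2)(1 + x + x²/2) = 1 + x⁴/4`.
  nlinarith [sq_nonneg (x ^ 2)]

theorem integrable_exp_and_integral_exp_le_of_moments_le (hX : 0 ≤ᵐ[P] X) {v : ℝ} (hv : 0 ≤ v)
    (hint : ∀ k : ℕ, Integrable (fun ω => X ω ^ k) P)
    (hmom : ∀ k : ℕ, ∫ ω, X ω ^ (k + 2) ∂P ≤ v * (k + 1).factorial) {l : ℝ} (hl : 0 < l)
    (hl1 : l < 1) :
    Integrable (fun ω => Real.exp (l * X ω)) P ∧
      ∫ ω, Real.exp (l * X ω) ∂P ≤ 1 + l * ∫ ω, X ω ∂P + l ^ 2 * v / (2 * (1 - l)) := by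
  set m : ℝ := ∫ ω, X ω ∂P
  have hm : 0 ≤ m := integral_nonneg_of_ae hX
  have hX1 : Integrable X P := by simpa using hint 1
  set g : ℕ → ℝ := fun k => ∫ ω, (l * X ω) ^ k / k.factorial ∂P
  have hterm : ∀ k : ℕ, Integrable (fun ω => (l * X ω) ^ k / k.factorial) P := fun k => by
    simp_rw [mul_pow]
    exact ((hint k).const_mul _).div_const _
  have hgk : ∀ k, g (k + 2) ≤ l ^ 2 * v / 2 * l ^ k := fun k => by
    have hE : g (k + 2) = l ^ (k + 2) / (k + 2).factorial * ∫ ω, X ω ^ (k + 2) ∂P := by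
      rw [← integral_const_mul]
      refine integral_congr_ae (Filter.Eventually.of_forall fun ω => ?_)
      simp only [mul_pow]
      ring
    rw [hE]
    calc l ^ (k + 2) / (k + 2).factorial * ∫ ω, X ω ^ (k + 2) ∂P
        ≤ l ^ (k + 2) / (k + 2).factorial * (v * (k + 1).factorial) := by
          gcongr
          exact hmom k
      _ = l ^ 2 * v * l ^ k / (k + 2) := by
          rw [Nat.factorial_succ (k + 1)]
          push_cast
          field_simp
          ring
      -- Bounding `1/(k + 2)` by `1/2` makes the tail geometric.
      _ ≤ l ^ 2 * v * l ^ k / 2 := by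
          gcongr
          linarith [(Nat.cast_nonneg k : (0 : ℝ) ≤ k)]
      _ = l ^ 2 * v / 2 * l ^ k := by ring
  have hg0 : ∀ k, 0 ≤ g k := fun k => integral_nonneg_of_ae <| by
    filter_upwards [hX] with ω hω
    have : 0 ≤ X ω := hω
    simp only [Pi.zero_apply]
    positivity
  have hgeo : HasSum (fun k : ℕ => l ^ 2 * v / 2 * l ^ k) (l ^ 2 * v / 2 * (1 - l)⁻¹) :=
    (hasSum_geometric_of_lt_one hl.le hl1).mul_left _
  have hsum2 : Summable fun k => g (k + 2) :=
    Summable.of_nonneg_of_le (fun k => hg0 _) hgk hgeo.summable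
  have hsum : Summable g := (summable_nat_add_iff 2).1 hsum2
  have htsum : ∑' k, g k ≤ 1 + l * m + l ^ 2 * v / (2 * (1 - l)) := by
    rw [← hsum.sum_add_tsum_nat_add 2, Finset.sum_range_succ, Finset.sum_range_one]
    have h0 : g 0 = 1 := by simp [g]
    have h1 : g 1 = l * m := by simp [g, m, integral_const_mul]
    rw [h0, h1]
    gcongr
    refine (hsum2.tsum_le_tsum hgk hgeo.summable).trans_eq ?_
    rw [hgeo.tsum_eq, mul_inv_eq_iff_eq_mul₀ (by linarith)]
    field_simp [show (1 - l) ≠ 0 by linarith]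
  -- In `ENNReal` sum and integral swap freely, so finiteness, hence integrability, comes with the
  -- value.
  have hlint : ∫⁻ ω, ENNReal.ofReal (Real.exp (l * X ω)) ∂P = ENNReal.ofReal (∑' k, g k) := by
    rw [ENNReal.ofReal_tsum_of_nonneg hg0 hsum]
    have hcongr : ∫⁻ ω, ENNReal.ofReal (Real.exp (l * X ω)) ∂P =
        ∫⁻ ω, ∑' k : ℕ, ENNReal.ofReal ((l * X ω) ^ k / k.factorial) ∂P := by
      refine lintegral_congr_ae ?_
      filter_upwards [hX] with ω hω
      have hω' : 0 ≤ X ω := hω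
      rw [← ENNReal.ofReal_tsum_of_nonneg (fun k => by positivity)
        (Real.summable_pow_div_factorial _), Real.exp_eq_exp_ℝ, NormedSpace.exp_eq_tsum_div]
    rw [hcongr, lintegral_tsum fun k => (hterm k).aemeasurable.ennreal_ofReal]
    refine tsum_congr fun k => ?_
    rw [ofReal_integral_eq_lintegral_ofReal (hterm k)]
    filter_upwards [hX] with ω hω
    have : 0 ≤ X ω := hω
    simp only [Pi.zero_apply]
    positivity
  have hmeas : AEStronglyMeasurable (fun ω => Real.exp (l * X ω)) P :=
    Real.continuous_exp.comp_aestronglyMeasurable (hX1.aestronglyMeasurable.const_mul l)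
  have hnn : 0 ≤ᵐ[P] fun ω => Real.exp (l * X ω) :=
    Filter.Eventually.of_forall fun ω => (Real.exp_pos _).le
  refine ⟨⟨hmeas, ?_⟩, ?_⟩
  · rw [hasFiniteIntegral_iff_ofReal hnn, hlint]
    exact ENNReal.ofReal_lt_top
  · rw [integral_eq_lintegral_of_nonneg_ae hnn hmeas, hlint,
      ENNReal.toReal_ofReal (tsum_nonneg hg0)]
    exact htsum

theorem isSubGammaRight_of_moments_le (hX : 0 ≤ᵐ[P] X) {v : ℝ} (hv : 0 ≤ v)
    (hint : ∀ k : ℕ, Integrable (fun ω => X ω ^ k) P)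
    (hmom : ∀ k : ℕ, ∫ ω, X ω ^ (k + 2) ∂P ≤ v * (k + 1).factorial) :
    IsSubGammaRight X v 1 P := by
  refine ⟨by simpa using hint 1, fun l hl hl1 => ?_⟩
  replace hl1 : l < 1 := by simpa using hl1
  obtain ⟨hI, hle⟩ := integrable_exp_and_integral_exp_le_of_moments_le hX hv hint hmom hl hl1
  set m : ℝ := ∫ ω, X ω ∂P
  have hexp : (fun ω => Real.exp (l * (X ω - m))) =
      fun ω => Real.exp (-(l * m)) * Real.exp (l * X ω) := by
    funext ω
    rw [← Real.exp_add]
    ring_nf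
  rw [hexp, integral_const_mul, one_mul]
  refine ⟨hI.const_mul _, ?_⟩
  calc Real.exp (-(l * m)) * ∫ ω, Real.exp (l * X ω) ∂P
      ≤ Real.exp (-(l * m)) * Real.exp (l * m + l ^ 2 * v / (2 * (1 - l))) := by
        gcongr
        refine hle.trans ?_
        linarith [Real.add_one_le_exp (l * m + l ^ 2 * v / (2 * (1 - l)))]
    _ = Real.exp (l ^ 2 * v / (2 * (1 - l))) := by
        rw [← Real.exp_add]
        ring_nf

theorem isSubGammaLeft_of_sq_moment_le (hX : 0 ≤ᵐ[P] X) {v c : ℝ} (hv : 0 ≤ v) (hc : 0 ≤ c)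
    (hX1 : Integrable X P) (hX2 : Integrable (fun ω => X ω ^ 2) P)
    (hmom : ∫ ω, X ω ^ 2 ∂P ≤ v) : IsSubGammaLeft X v c P := by
  refine ⟨hX1.neg, fun l hl hlc => ?_⟩
  set m : ℝ := ∫ ω, X ω ∂P
  have hcl : c * l < 1 := by
    rcases hc.eq_or_lt with rfl | hc
    · simp
    · have := hlc.resolve_left hc.ne'
      rwa [lt_div_iff₀ hc, mul_comm] at this
  have hcl0 : 0 ≤ c * l := by positivity
  have hexp : (fun ω => Real.exp (l * (-X ω - ∫ ω', -X ω' ∂P))) =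
      fun ω => Real.exp (l * m) * Real.exp (-(l * X ω)) := by
    funext ω
    rw [← Real.exp_add, integral_neg]
    ring_nf
    rfl
  have hquad : Integrable (fun ω => 1 - l * X ω + l ^ 2 / 2 * X ω ^ 2) P :=
    ((integrable_const 1).sub (hX1.const_mul l)).add (hX2.const_mul _)
  have hbound : ∀ᵐ ω ∂P, Real.exp (-(l * X ω)) ≤ 1 - l * X ω + l ^ 2 / 2 * X ω ^ 2 := by
    filter_upwards [hX] with ω hω
    refine (Real.exp_neg_le_one_sub_add_sq_div_two (mul_nonneg hl.le hω)).trans_eq ?_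
    ring
  have hI : Integrable (fun ω => Real.exp (-(l * X ω))) P := by
    refine hquad.mono' (Real.continuous_exp.comp_aestronglyMeasurable
      (hX1.aestronglyMeasurable.const_mul l).neg) ?_
    simpa [Real.norm_eq_abs] using hbound
  rw [hexp, integral_const_mul]
  refine ⟨hI.const_mul _, ?_⟩
  have hle : ∫ ω, Real.exp (-(l * X ω)) ∂P ≤ 1 - l * m + l ^ 2 / 2 * v := by
    refine (integral_mono_ae hI hquad hbound).trans ?_
    rw [integral_add (f := fun ω => 1 - l * X ω)
      ((integrable_const 1).sub (hX1.const_mul l)) (hX2.const_mul _), integral_sub (integrable_const 1) (hX1.const_mul l), integral_const_mul,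
      integral_const_mul]
    simp only [integral_const, probReal_univ, one_smul]
    gcongr
  calc Real.exp (l * m) * ∫ ω, Real.exp (-(l * X ω)) ∂P
      ≤ Real.exp (l * m) * Real.exp (-(l * m) + l ^ 2 * v / 2) := by
        gcongr
        refine hle.trans ?_
        linarith [Real.add_one_le_exp (-(l * m) + l ^ 2 * v / 2)]
    _ = Real.exp (l ^ 2 * v / 2) := by
        rw [← Real.exp_add]
        ring_nf
    -- The bound already holds with scale 0; any `c ≥ 0` only weakens it.
    _ ≤ Real.exp (l ^ 2 * v / (2 * (1 - c * l))) := by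
        gcongr
        linarith

end SubGammaCriteria

/-! ### Moments of the generalized Gamma distribution -/

section GGamma

theorem ggammaPDFReal_nonneg {a b : ℝ} (ha : 0 < a) (hb : 0 < b) (x : ℝ) :
    0 ≤ ggammaPDFReal a b x := by
  have hG : 0 < Real.Gamma (a / b) := Real.Gamma_pos_of_pos (div_pos ha hb)
  unfold ggammaPDFReal
  split_ifs with hx
  · positivity
  · exact le_rfl

theorem measurable_ggammaPDFReal (a b : ℝ) : Measurable (ggammaPDFReal a b) :=
  Measurable.ite measurableSet_Ioi (by fun_prop) measurable_const

theorem ggammaPDFReal_mul_eq_indicator (a b : ℝ) (f : ℝ → ℝ) :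
    (fun x => ggammaPDFReal a b x * f x) = (Set.Ioi (0 : ℝ)).indicator
      (fun x => b / Real.Gamma (a / b) * (x ^ (a - 1) * Real.exp (-x ^ b) * f x)) := by
  funext x
  by_cases hx : 0 < x
  · simp only [ggammaPDFReal, hx, if_true, Set.indicator, Set.mem_Ioi]
    ring
  · simp [ggammaPDFReal, hx, Set.indicator]

theorem integral_ggammaMeasure {a b : ℝ} (ha : 0 < a) (hb : 0 < b) (f : ℝ → ℝ) :
    ∫ x, f x ∂ggammaMeasure a b = b / Real.Gamma (a / b) *
      ∫ x in Set.Ioi (0 : ℝ), x ^ (a - 1) * Real.exp (-x ^ b) * f x := by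
  rw [ggammaMeasure, integral_withDensity_eq_integral_toReal_smul
    (measurable_ggammaPDFReal a b).ennreal_ofReal (by simp)]
  simp_rw [ENNReal.toReal_ofReal (ggammaPDFReal_nonneg ha hb _), smul_eq_mul]
  rw [ggammaPDFReal_mul_eq_indicator, integral_indicator measurableSet_Ioi, integral_const_mul]

theorem integrable_ggammaMeasure {a b : ℝ} (ha : 0 < a) (hb : 0 < b) {f : ℝ → ℝ}
    (hf : IntegrableOn (fun x => x ^ (a - 1) * Real.exp (-x ^ b) * f x) (Set.Ioi 0)) :
    Integrable f (ggammaMeasure a b) := by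
  rw [ggammaMeasure, integrable_withDensity_iff_integrable_smul'
    (measurable_ggammaPDFReal a b).ennreal_ofReal (by simp)]
  simp_rw [ENNReal.toReal_ofReal (ggammaPDFReal_nonneg ha hb _), smul_eq_mul]
  rw [ggammaPDFReal_mul_eq_indicator, integrable_indicator_iff measurableSet_Ioi]
  exact hf.const_mul _

theorem rpow_sub_one_mul_exp_mul_pow (a b : ℝ) (k : ℕ) :
    Set.EqOn (fun x : ℝ => x ^ (a + k - 1) * Real.exp (-x ^ b))
      (fun x => x ^ (a - 1) * Real.exp (-x ^ b) * x ^ k) (Set.Ioi 0) := fun x hx => by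
  have hx' : (0 : ℝ) < x := hx
  simp only
  rw [show a + k - 1 = a - 1 + k by ring, Real.rpow_add hx', Real.rpow_natCast]
  ring

theorem integrable_pow_ggammaMeasure {a b : ℝ} (ha : 0 < a) (hb : 0 < b) (k : ℕ) :
    Integrable (fun x => x ^ k) (ggammaMeasure a b) := by
  have hk : (0 : ℝ) ≤ k := k.cast_nonneg
  exact integrable_ggammaMeasure ha hb <|
    (integrableOn_rpow_mul_exp_neg_rpow (s := a + k - 1) (by linarith) hb).congr_fun
      (rpow_sub_one_mul_exp_mul_pow a b k) measurableSet_Ioi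

theorem integral_pow_ggammaMeasure {a b : ℝ} (ha : 0 < a) (hb : 0 < b) (k : ℕ) :
    ∫ x, x ^ k ∂ggammaMeasure a b = Real.Gamma ((a + k) / b) / Real.Gamma (a / b) := by
  have hk : (0 : ℝ) ≤ k := k.cast_nonneg
  rw [integral_ggammaMeasure ha hb,
    ← setIntegral_congr_fun measurableSet_Ioi (rpow_sub_one_mul_exp_mul_pow a b k),
    integral_rpow_mul_exp_neg_rpow hb (by linarith), sub_add_cancel]
  field_simp

theorem ae_pos_ggammaMeasure (a b : ℝ) : ∀ᵐ x ∂ggammaMeasure a b, 0 < x := by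
  rw [ggammaMeasure, ae_withDensity_iff (measurable_ggammaPDFReal a b).ennreal_ofReal]
  refine Filter.Eventually.of_forall fun x hx => ?_
  by_contra h
  exact hx (by simp [ggammaPDFReal, h])

end GGamma

/-! ### The generalized Gaussian and the law of `|x|^(p-1)` -/

section GGauss

theorem integral_exp_neg_abs_rpow {p : ℝ} (hp : 0 < p) :
    ∫ x : ℝ, Real.exp (-|x| ^ p) = 2 * Real.Gamma (1 / p + 1) := by
  rw [integral_comp_abs (f := fun x => Real.exp (-x ^ p)), integral_exp_neg_rpow hp]

theorem integrable_exp_neg_abs_rpow {p : ℝ} (hp : 0 < p) :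
    Integrable fun x : ℝ => Real.exp (-|x| ^ p) := by
  by_contra h
  have h1 := integral_exp_neg_abs_rpow hp
  -- A non-integrable function has integral 0 by convention, contradicting the positive value.
  rw [integral_undef h] at h1
  have := Real.Gamma_pos_of_pos (show 0 < 1 / p + 1 by positivity)
  linarith

theorem integral_ggaussMeasure {p : ℝ} (hp : 0 < p) (f : ℝ → ℝ) :
    ∫ x, f x ∂ggaussMeasure p =
      (2 * Real.Gamma (1 / p + 1))⁻¹ * ∫ x : ℝ, Real.exp (-|x| ^ p) * f x := by
  rw [ggaussMeasure, integral_smul_measure,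
    ← ofReal_integral_eq_lintegral_ofReal (integrable_exp_neg_abs_rpow hp)
      (Filter.Eventually.of_forall fun x => (Real.exp_pos _).le),
    integral_exp_neg_abs_rpow hp, integral_withDensity_eq_integral_toReal_smul
      (by fun_prop) (by simp)]
  have := Real.Gamma_pos_of_pos (show 0 < 1 / p + 1 by positivity)
  simp_rw [ENNReal.toReal_ofReal (Real.exp_pos _).le]
  rw [ENNReal.toReal_inv, ENNReal.toReal_ofReal (by positivity)]
  rfl

theorem isProbabilityMeasure_ggaussMeasure {p : ℝ} (hp : 0 < p) :
    IsProbabilityMeasure (ggaussMeasure p) := by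
  have hI := ofReal_integral_eq_lintegral_ofReal (integrable_exp_neg_abs_rpow hp)
      (Filter.Eventually.of_forall fun x => (Real.exp_pos _).le)
  have := Real.Gamma_pos_of_pos (show 0 < 1 / p + 1 by positivity)
  refine ⟨?_⟩
  rw [ggaussMeasure, Measure.smul_apply, withDensity_apply _ MeasurableSet.univ,
    Measure.restrict_univ, ← hI, integral_exp_neg_abs_rpow hp, smul_eq_mul]
  exact ENNReal.inv_mul_cancel (by simpa using this) ENNReal.ofReal_ne_top

/-- Fold onto the half-line by symmetry and substitute `y = x^(p-1)`: the Jacobian cancels the power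
of `y` in the density, and `y^(p/(p-1)) = x^p`. -/
theorem integral_comp_abs_rpow_ggaussMeasure {p : ℝ} (hp : 1 < p) (f : ℝ → ℝ) :
    ∫ x, f (|x| ^ (p - 1)) ∂ggaussMeasure p =
      ∫ y, f y ∂ggammaMeasure (1 / (p - 1)) (p / (p - 1)) := by
  have hq : 0 < p - 1 := by linarith
  have hp0 : 0 < p := by linarith
  rw [integral_ggaussMeasure hp0, integral_ggammaMeasure (by positivity) (by positivity),
    integral_comp_abs (f := fun x => Real.exp (-x ^ p) * f (x ^ (p - 1))),
    ← integral_comp_rpow_Ioi (fun y => y ^ (1 / (p - 1) - 1) * Real.exp (-y ^ (p / (p - 1))) * f y)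
      hq.ne']
  have hcongr : Set.EqOn (fun x : ℝ => (|p - 1| * x ^ (p - 1 - 1)) •
        ((x ^ (p - 1)) ^ (1 / (p - 1) - 1) * Real.exp (-(x ^ (p - 1)) ^ (p / (p - 1))) *
          f (x ^ (p - 1))))
      (fun x => (p - 1) * (Real.exp (-x ^ p) * f (x ^ (p - 1)))) (Set.Ioi 0) := fun x hx => by
    have hx' : (0 : ℝ) < x := hx
    have h1 : x ^ (p - 1 - 1) * (x ^ (p - 1)) ^ (1 / (p - 1) - 1) = 1 := by
      rw [← Real.rpow_mul hx'.le, ← Real.rpow_add hx',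
        show p - 1 - 1 + (p - 1) * (1 / (p - 1) - 1) = 0 by field_simp; ring, Real.rpow_zero]
    have h2 : (x ^ (p - 1)) ^ (p / (p - 1)) = x ^ p := by
      rw [← Real.rpow_mul hx'.le, mul_div_cancel₀ _ hq.ne']
    simp only [smul_eq_mul]
    rw [h2, abs_of_pos hq]
    linear_combination (p - 1) * (Real.exp (-x ^ p) * f (x ^ (p - 1))) * h1
  rw [setIntegral_congr_fun measurableSet_Ioi hcongr, integral_const_mul,
    Real.Gamma_add_one (by positivity),
    show 1 / (p - 1) / (p / (p - 1)) = 1 / p by field_simp]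
  have := Real.Gamma_pos_of_pos (show 0 < 1 / p by positivity)
  field_simp

theorem hasLaw_abs_rpow_ggaussMeasure {p : ℝ} (hp : 1 < p) :
    HasLaw (fun x : ℝ => |x| ^ (p - 1)) (ggammaMeasure (1 / (p - 1)) (p / (p - 1)))
      (ggaussMeasure p) := by
  have hq : 0 < p - 1 := by linarith
  have hp0 : 0 < p := by linarith
  have hmeas : Measurable fun x : ℝ => |x| ^ (p - 1) := by fun_prop
  have := isProbabilityMeasure_ggaussMeasure hp0
  have := isProbabilityMeasure_ggammaMeasure (a := 1 / (p - 1)) (b := p / (p - 1))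
    (by positivity) (by positivity)
  refine ⟨hmeas.aemeasurable, ?_⟩
  have := Measure.isProbabilityMeasure_map (μ := ggaussMeasure p) hmeas.aemeasurable
  refine Measure.ext fun s hs => ?_
  rw [← measureReal_eq_measureReal_iff, ← integral_indicator_one hs, ← integral_indicator_one hs,
    integral_map hmeas.aemeasurable
      ((measurable_one.indicator hs).aestronglyMeasurable)]
  exact integral_comp_abs_rpow_ggaussMeasure hp _

end GGauss

/-! ### Assembly -/

theorem mainTheorem6 {Ω : Type*} [MeasurableSpace Ω] (P : Measure Ω) [IsProbabilityMeasure P]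
    (p : ℝ) (hp : 4 ≤ p) (Y : Ω → ℝ)
    (hY : HasLaw Y (ggammaMeasure (1 / (p - 1)) (p / (p - 1))) P) :
    HasLaw (fun x : ℝ => |x| ^ (p - 1)) (ggammaMeasure (1 / (p - 1)) (p / (p - 1)))
      (ggaussMeasure p) ∧
    Integrable Y P ∧
    ∫ ω, Y ω ∂P = 1 / Real.Gamma (1 / p) ∧
    ∫ ω, Y ω ∂P ∈ Set.Ico (1 / p) (1.2 / p) ∧
    IsSubGammaRight Y (∫ ω, Y ω ∂P) 1 P ∧
    IsSubGammaLeft Y (∫ ω, Y ω ∂P) (3 / 2) P := by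
  have hq : 0 < p - 1 := by linarith
  have hp0 : 0 < p := by linarith
  have ha : 0 < 1 / (p - 1) := by positivity
  have hb : 0 < p / (p - 1) := by positivity
  have hG : 0 < Real.Gamma (1 / p) := Real.Gamma_pos_of_pos (by positivity)
  have hint : ∀ k : ℕ, Integrable (fun ω => Y ω ^ k) P := fun k => by
    have h := integrable_pow_ggammaMeasure ha hb k
    rw [← hY.map_eq] at h
    exact h.comp_aemeasurable hY.aemeasurable
  have hmom : ∀ k : ℕ, ∫ ω, Y ω ^ (k + 1) ∂P =
      1 / Real.Gamma (1 / p) * Real.Gamma (k + 1 - k * (1 / p)) := fun k => by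
    have h := hY.integral_comp (f := fun x : ℝ => x ^ (k + 1))
      (by fun_prop : Measurable fun x : ℝ => x ^ (k + 1)).aestronglyMeasurable
    rw [integral_pow_ggammaMeasure ha hb] at h
    refine h.trans ?_
    rw [show 1 / (p - 1) / (p / (p - 1)) = 1 / p by field_simp,
      show (1 / (p - 1) + ((k + 1 : ℕ) : ℝ)) / (p / (p - 1)) = k + 1 - k * (1 / p) by
        push_cast
        field_simp
        ring]
    ring
  have hmean : ∫ ω, Y ω ∂P = 1 / Real.Gamma (1 / p) := by simpa using hmom 0
  have hle : ∀ k : ℕ, ∫ ω, Y ω ^ (k + 2) ∂P ≤ (∫ ω, Y ω ∂P) * (k + 1).factorial := fun k => by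
    rw [hmom (k + 1), hmean]
    have hinv : 1 / p ≤ 1 := by rw [div_le_one hp0]; linarith
    have hinv0 : 0 < 1 / p := by positivity
    have hk : (0 : ℝ) ≤ ((k + 1 : ℕ) : ℝ) := Nat.cast_nonneg _
    gcongr
    -- The argument `k + 2 - (k + 1)/p` lies in `[1, k + 2]` because `0 < 1/p ≤ 1`.
    exact Real.Gamma_le_factorial_of_mem_Icc ⟨by nlinarith, by nlinarith⟩
  have hpos : 0 ≤ᵐ[P] Y := by
    have h := ae_pos_ggammaMeasure (1 / (p - 1)) (p / (p - 1))
    rw [← hY.map_eq] at h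
    exact (ae_of_ae_map hY.aemeasurable h).mono fun ω hω => hω.le
  have hmean0 : 0 ≤ ∫ ω, Y ω ∂P := integral_nonneg_of_ae hpos
  have hY1 : Integrable Y P := by simpa using hint 1
  refine ⟨hasLaw_abs_rpow_ggaussMeasure (by linarith), hY1, hmean,
    hmean ▸ Real.one_div_Gamma_one_div_mem_Ico hp,
    isSubGammaRight_of_moments_le hpos hmean0 hint hle,
    isSubGammaLeft_of_sq_moment_le hpos hmean0 (by norm_num) hY1 (hint 2) ?_⟩
  simpa using hle 0
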